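/- **Setting.** Let $M\ge 2$ and let $\mathcal S=\{s_0,\dots,s_{M-1}\}\subset\mathbb C$ be a constellation of $M$ distinct symbols with $\frac1M\sum_j|s_j|^2=1$ (for instance any $M$-QAM constellation), used with equal probabilities. For the channel $y=\sqrt\gamma\,s+z$ with $z\sim\mathcal{CN}(0,1)$ independent of $s$, let $$\mathcal I_M(\gamma)=\log_2\frac Me-\frac1{M\pi}\sum_{j=0}^{M-1}\int_{\mathbb C}e^{-|u-\sqrt\gamma s_j|^2}\log_2\Big(\sum_{k=0}^{M-1}e^{-|u-\sqrt\gamma s_k|^2}\Big)du$$ be the mutual information in bits, and let $\mathsf{MMSE}_M(\gamma)=\mathbb E\,|s-\mathbb E[s\mid y]|^2$. A mixture Gamma distribution with $L$ components has parameters $\alpha_l\ge0$, $\beta_l>0$, $\zeta_l>0$ with $\sum_{l=1}^L\alpha_l\Gamma(\beta_l)\zeta_l^{-\beta_l}=1$, and density $f(\gamma)=\sum_{l=1}^L\alpha_l\gamma^{\beta_l-1}e^{-\zeta_l\gamma}$ on $(0,\infty)$. The eavesdropper's SNR $\gamma_{\rm E}$ has a fixed mixture Gamma law with density $f_{\rm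 E}$ and distribution function $F_{\rm E}$. The main channel's SNR $\gamma_{\rm B}$, independent of $\gamma_{\rm E}$, has a mixture Gamma law with $L_{\rm B}\geq 1$ components whose parameters $\alpha_{{\rm B},l},\beta_{{\rm B},l},\zeta_{{\rm B},l}$ depend on its mean $\bar\gamma_{\rm B}=\mathbb E\,\gamma_{\rm B}$. Assume that $\zeta_{{\rm B},l}\to0$ for every $l$ as $\bar\gamma_{\rm B}\to\infty$, and that there are constants $\Phi_{{\rm B},l}>0$, $0<\Lambda_{{\rm B},1}\le\dots\le\Lambda_{{\rm B},L_{\rm B}}$ and $0<\Psi_{{\rm B},1}\le\dots\le\Psi_{{\rm B},L_{\rm B}}$, not depending on $\bar\gamma_{\rm B}$, such that for all sufficiently large $\bar\gamma_{\rm B}$ and all $\gamma>0$ $$\sum_{l=1}^{L_{\rm B}}\frac{\alpha_{{\rm B},l}}{\beta_{{\rm B},l}}\gamma^{\beta_{{\rm B},l}}=\sum_{l=1}^{L_{\rm B}}\Phi_{{\rm B},l}\,\gamma^{\Lambda_{{\rm B},l}}\,\bar\gamma_{\rm B}^{-\Psi_{{\rm B},l}} .$$ Let $\bar{\mathcal I}_{\rm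 s}=\mathbb E\max\{\mathcal I_M(\gamma_{\rm B})-\mathcal I_M(\gamma_{\rm E}),0\}$ be the average secrecy rate, and put $$\mathcal I_{\rm lim}=\log_2M-\int_0^\infty\mathcal I_M(\gamma)f_{\rm E}(\gamma)\,d\gamma,\qquad \Theta_{M,l}=\int_0^\infty\gamma^{\Lambda_{{\rm B},l}}F_{\rm E}(\gamma)\,\mathsf{MMSE}_M(\gamma)\,d\gamma,$$ so that $\Theta_{M,l}$ is the Mellin transform of $F_{\rm E}\cdot\mathsf{MMSE}_M$ at $\Lambda_{{\rm B},l}+1$, and $$G_{d,{\rm B}}=\Psi_{{\rm B},1},\qquad G_{a,{\rm B},M}=(\log_2e)\sum_{l:\,\Psi_{{\rm B},l}=\Psi_{{\rm B},1}}\Phi_{{\rm B},l}\,\Theta_{M,l}.$$ **Claim.** The integrals defining $\mathcal I_{\rm lim}$ and all $\Theta_{M,l}$ converge absolutely, $\Theta_{M,l}\in(0,\infty)$ for every $l$, $G_{a,{\rm B},M}>0$, and, as $\bar\gamma_{\rm B}\to\infty$ with the eavesdropper's law fixed, $$\bar{\mathcal I}_{\rm s}=\mathcal I_{\rm lim}-G_{a,{\rm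 B},M}\,\bar\gamma_{\rm B}^{-G_{d,{\rm B}}}+o\big(\bar\gamma_{\rm B}^{-G_{d,{\rm B}}}\big).$$ Hence $\bar{\mathcal I}_{\rm s}\to\mathcal I_{\rm lim}$, and the secrecy diversity order is $\Psi_{{\rm B},1}$: $$-\lim_{\bar\gamma_{\rm B}\to\infty}\frac{\log(\mathcal I_{\rm lim}-\bar{\mathcal I}_{\rm s})}{\log\bar\gamma_{\rm B}}=\Psi_{{\rm B},1}.$$ -/

import Mathlib

open Filter Topology MeasureTheory Asymptotics Set

namespace Wiretap

noncomputable section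

/-- A signal constellation of `M` distinct complex symbols, used with equal probabilities and
normalised to unit average energy; every `M`-QAM constellation is of this kind. -/
structure Constellation (M : ℕ) where
  symbol : Fin M → ℂ
  symbol_injective : Function.Injective symbol
  unit_energy : (1 / (M : ℝ)) * ∑ j, ‖symbol j‖ ^ 2 = 1

namespace Constellation

variable {M : ℕ} (S : Constellation M)

/-- The likelihood kernel `exp (-|u - √γ s_j|²)` of the output `u` of the channel
`y = √γ s + z`, `z ∼ CN(0,1)`, given that the symbol `s_j` was sent
(the conditional density of `y` is this kernel divided by `π`). -/
def kernel (γ : ℝ) (j : Fin M) (u : ℂ) : ℝ :=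
  Real.exp (-‖u - (Real.sqrt γ : ℂ) * S.symbol j‖ ^ 2)

/-- `L_M(γ) = (1 / (M π)) ∑_j ∫_ℂ exp(-|u - √γ s_j|²) log₂ (∑_k exp(-|u - √γ s_k|²)) du`. -/
def lossIntegral (γ : ℝ) : ℝ :=
  (1 / ((M : ℝ) * Real.pi)) *
    ∑ j, ∫ u : ℂ, S.kernel γ j u * Real.logb 2 (∑ k, S.kernel γ k u)

/-- The mutual information in bits, `I_M(γ) = log₂ (M / e) - L_M(γ)`. -/
def mutualInfo (γ : ℝ) : ℝ :=
  Real.logb 2 ((M : ℝ) / Real.exp 1) - S.lossIntegral γ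

/-- The conditional mean `E[s | y = u]` for equiprobable symbols and `y = √γ s + z`. -/
def condMean (γ : ℝ) (u : ℂ) : ℂ :=
  (∑ k, (S.kernel γ k u : ℂ) * S.symbol k) / ((∑ k, S.kernel γ k u : ℝ) : ℂ)

/-- The minimum mean square error `E |s - E[s | y]|²` of estimating `s` from `y = √γ s + z`. -/
def mmse (γ : ℝ) : ℝ :=
  (1 / ((M : ℝ) * Real.pi)) *
    ∑ j, ∫ u : ℂ, ‖S.symbol j - S.condMean γ u‖ ^ 2 * S.kernel γ j u

end Constellation

/-- The parameters of a mixture Gamma distribution with `L` components. -/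
structure MixtureGamma (L : ℕ) where
  α : Fin L → ℝ
  β : Fin L → ℝ
  ζ : Fin L → ℝ
  α_nonneg : ∀ l, 0 ≤ α l
  β_pos : ∀ l, 0 < β l
  ζ_pos : ∀ l, 0 < ζ l
  normalized : ∑ l, α l * Real.Gamma (β l) * ζ l ^ (-β l) = 1

namespace MixtureGamma

variable {L : ℕ} (P : MixtureGamma L)

/-- The density on `(0, ∞)`. -/
def pdf (x : ℝ) : ℝ :=
  ∑ l, P.α l * x ^ (P.β l - 1) * Real.exp (-(P.ζ l * x))

/-- The cumulative distribution function. -/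
def cdf (x : ℝ) : ℝ :=
  ∫ t in Ioc 0 x, P.pdf t

/-- The mean, i.e. the average SNR `E |h|²` when the SNR `γ = |h|²` has this distribution. -/
def mean : ℝ :=
  ∫ x in Ioi (0 : ℝ), x * P.pdf x

end MixtureGamma

/-- The average secrecy rate: the expectation of the instantaneous secrecy rate
`max (I_M(γ_B) - I_M(γ_E)) 0` over independent SNRs `γ_B` and `γ_E`. -/
def avgSecrecyRate {M LB LE : ℕ} (S : Constellation M)
    (bob : MixtureGamma LB) (eve : MixtureGamma LE) : ℝ :=
  ∫ y in Ioi (0 : ℝ), ∫ x in Ioi (0 : ℝ),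
    max (S.mutualInfo x - S.mutualInfo y) 0 * bob.pdf x * eve.pdf y

/-- `I_lim = log₂ M - ∫₀^∞ I_M(γ) f_E(γ) dγ`. -/
def rateLimit {M LE : ℕ} (S : Constellation M) (eve : MixtureGamma LE) : ℝ :=
  Real.logb 2 M - ∫ γ in Ioi (0 : ℝ), S.mutualInfo γ * eve.pdf γ

/-- The (real) Mellin transform `∫₀^∞ t^(z-1) f(t) dt`. -/
def realMellin (f : ℝ → ℝ) (z : ℝ) : ℝ :=
  ∫ t in Ioi (0 : ℝ), t ^ (z - 1) * f t

/-- The Mellin transform of `F_E · MMSE_M` at `lam + 1`. -/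
def mellinCoeff {M LE : ℕ} (S : Constellation M) (eve : MixtureGamma LE) (lam : ℝ) : ℝ :=
  realMellin (fun γ => eve.cdf γ * S.mmse γ) (lam + 1)

/-- The array gain `(log₂ e) ∑_{l : Ψ_l = Ψ_1} Φ_l Θ_l`. The factor `log₂ e` is there because
rates are in bits: the derivative of `I_M` is `(log₂ e) MMSE_M`. -/
def arrayGain {M LB LE : ℕ} [NeZero LB] (S : Constellation M) (eve : MixtureGamma LE)
    (Φ Λ Ψ : Fin LB → ℝ) : ℝ :=
  Real.logb 2 (Real.exp 1) *
    ∑ l, if Ψ l = Ψ 0 then Φ l * mellinCoeff S eve (Λ l) else 0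

end

end Wiretap

namespace Wiretap

/-! ### Gaussian integrals on the complex plane -/

/-! The proof rests on an exact formula for the gap (`rateLimit_sub_avgSecrecyRate`): the limit rate
minus the average secrecy rate is `log₂ e` times the integral of `F_B · F_E · MMSE` over `(0, ∞)`.
It comes from writing the mutual information as a tail integral of the MMSE and applying Fubini once
for each SNR. This uses `I_M' = (log₂ e) MMSE ≥ 0` and `I_M → log₂ M`.

The derivative formula is obtained in the variable `r = √γ`. After translating the noise, only a
log-sum-exp depends on `r`; differentiating it under the integral and summing over the sent symbol
leaves a posterior variance (`sum_sum_inner_eq_variance`). Decay in `γ` comes from the geometric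
mean of two kernels, whose integral is `π exp (-γ |s_j - s_k|² / 4)`; it dominates both the
estimation error and the equivocation.

For the asymptotics, `F_B` lies between its leading power sum and that sum times `exp (-z t)`, where
`z = ∑ ζ_l → 0`. The fading hypothesis rewrites the power sum as `∑ Φ_l t^Λ_l g^(-Ψ_l)`. Dominated
convergence and a squeeze then give `g^Ψ_0 · gap → G_a > 0`, from which the expansion, the
saturation and the diversity order all follow. -/

theorem integral_exp_neg_norm_sq : ∫ w : ℂ, Real.exp (-‖w‖ ^ 2) = Real.pi := by
  have h := GaussianFourier.integral_rexp_neg_mul_sq_norm (V := ℂ) (b := 1) one_pos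
  simpa [Complex.finrank_real_complex] using h

/-- A non-integrable function has Bochner integral `0`, so a nonzero value of the integral already
proves integrability. -/
theorem integrable_exp_neg_norm_sq : Integrable fun w : ℂ => Real.exp (-‖w‖ ^ 2) :=
  .of_integral_ne_zero (by rw [integral_exp_neg_norm_sq]; exact Real.pi_ne_zero)

theorem integral_norm_sq_mul_exp : ∫ w : ℂ, ‖w‖ ^ 2 * Real.exp (-‖w‖ ^ 2) = Real.pi := by
  have h := Complex.integral_rpow_mul_exp_neg_rpow (p := 2) (q := 2) (by norm_num) (by norm_num)
  have h2 : Real.Gamma 2 = 1 := Real.Gamma_two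
  norm_num [h2] at h
  exact h

theorem integrable_norm_sq_mul_exp :
    Integrable fun w : ℂ => ‖w‖ ^ 2 * Real.exp (-‖w‖ ^ 2) :=
  .of_integral_ne_zero (by rw [integral_norm_sq_mul_exp]; exact Real.pi_ne_zero)

theorem integral_exp_neg_norm_sub_sq (c : ℂ) :
    ∫ u : ℂ, Real.exp (-‖u - c‖ ^ 2) = Real.pi := by
  rw [integral_sub_right_eq_self (fun u : ℂ => Real.exp (-‖u‖ ^ 2)) c, integral_exp_neg_norm_sq]

theorem integrable_exp_neg_norm_sub_sq (c : ℂ) :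
    Integrable fun u : ℂ => Real.exp (-‖u - c‖ ^ 2) :=
  integrable_exp_neg_norm_sq.comp_sub_right c

/-! ### Likelihood kernels and their pairwise overlaps -/

namespace Constellation

noncomputable section

variable {M : ℕ} (S : Constellation M) {γ : ℝ}

/-- The unnormalised density of the channel output: the sum of all likelihood kernels. -/
def evidence (γ : ℝ) (u : ℂ) : ℝ := ∑ k, S.kernel γ k u

theorem kernel_pos (γ : ℝ) (j : Fin M) (u : ℂ) : 0 < S.kernel γ j u := Real.exp_pos _

theorem continuous_kernel (γ : ℝ) (j : Fin M) : Continuous (S.kernel γ j) := by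
  unfold kernel; fun_prop

theorem continuous_evidence (γ : ℝ) : Continuous (S.evidence γ) :=
  continuous_finsetSum _ fun k _ => S.continuous_kernel γ k

theorem kernel_le_evidence (γ : ℝ) (j : Fin M) (u : ℂ) : S.kernel γ j u ≤ S.evidence γ u :=
  Finset.single_le_sum (f := fun k => S.kernel γ k u) (fun k _ => (S.kernel_pos γ k u).le)
    (Finset.mem_univ j)

theorem evidence_pos (j : Fin M) (γ : ℝ) (u : ℂ) : 0 < S.evidence γ u :=
  (S.kernel_pos γ j u).trans_le (S.kernel_le_evidence γ j u)

/-- The geometric mean of two likelihood kernels. -/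
def overlap (γ : ℝ) (j k : Fin M) (u : ℂ) : ℝ :=
  Real.exp (-‖u - (Real.sqrt γ : ℂ) * ((S.symbol j + S.symbol k) / 2)‖ ^ 2) *
    Real.exp (-(γ * (‖S.symbol j - S.symbol k‖ ^ 2 / 4)))

theorem overlap_pos (γ : ℝ) (j k : Fin M) (u : ℂ) : 0 < S.overlap γ j k u := by
  unfold overlap; positivity

/-- By the parallelogram law, the product of two Gaussian kernels is the square of a Gaussian
centred at the midpoint, times a factor depending only on the distance of the centres. That factor
is the source of all exponential decay in `γ`. -/
theorem overlap_sq (hγ : 0 ≤ γ) (j k : Fin M) (u : ℂ) :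
    S.overlap γ j k u ^ 2 = S.kernel γ j u * S.kernel γ k u := by
  set r : ℂ := (Real.sqrt γ : ℂ)
  have hr : ‖r‖ ^ 2 = γ := by simp [r, Real.sq_sqrt hγ]
  have h := parallelogram_law_with_norm ℝ (u - r * S.symbol j) (u - r * S.symbol k)
  have e1 : u - r * S.symbol j + (u - r * S.symbol k) =
      2 * (u - r * ((S.symbol j + S.symbol k) / 2)) := by ring
  have e2 : u - r * S.symbol j - (u - r * S.symbol k) = -(r * (S.symbol j - S.symbol k)) := by
    ring
  rw [e1, e2, norm_neg, norm_mul, norm_mul, mul_pow, mul_pow, hr, Complex.norm_ofNat] at h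
  simp only [overlap, kernel]
  rw [← Real.exp_add, ← Real.exp_add, sq, ← Real.exp_add]
  congr 1
  linarith

theorem integrable_overlap (γ : ℝ) (j k : Fin M) : Integrable (S.overlap γ j k) :=
  (integrable_exp_neg_norm_sub_sq _).mul_const _

theorem integral_overlap (γ : ℝ) (j k : Fin M) :
    ∫ u, S.overlap γ j k u =
      Real.pi * Real.exp (-(γ * (‖S.symbol j - S.symbol k‖ ^ 2 / 4))) := by
  unfold overlap
  rw [integral_mul_const, integral_exp_neg_norm_sub_sq]

/-- Both kernels are at most the evidence, so the left side is at most the smaller of the two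
kernels, hence at most their geometric mean. -/
theorem kernel_mul_le_overlap (hγ : 0 ≤ γ) (j k : Fin M) (u : ℂ) :
    S.kernel γ j u * (S.kernel γ k u / S.evidence γ u) ≤ S.overlap γ j k u := by
  have hj := S.kernel_pos γ j u
  have hk := S.kernel_pos γ k u
  have hE := S.evidence_pos j γ u
  have hjE := S.kernel_le_evidence γ j u
  have hkE := S.kernel_le_evidence γ k u
  refine le_of_sq_le_sq ?_ (S.overlap_pos γ j k u).le
  rw [S.overlap_sq hγ]
  have : S.kernel γ j u * (S.kernel γ k u / S.evidence γ u) ≤ S.kernel γ j u :=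
    mul_le_of_le_one_right hj.le ((div_le_one hE).2 hkE)
  have h2 : S.kernel γ j u * (S.kernel γ k u / S.evidence γ u) ≤ S.kernel γ k u := by
    rw [mul_div_assoc', div_le_iff₀ hE, mul_comm]
    exact mul_le_mul_of_nonneg_left hjE hk.le
  rw [sq]
  exact mul_le_mul this h2 (by positivity) hj.le

/-! ### Estimation error -/

theorem sum_posterior (j : Fin M) (γ : ℝ) (u : ℂ) :
    ∑ k, S.kernel γ k u / S.evidence γ u = 1 := by
  rw [← Finset.sum_div]; exact div_self (S.evidence_pos j γ u).ne'

theorem condMean_eq (γ : ℝ) (u : ℂ) :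
    S.condMean γ u = ∑ k, (S.kernel γ k u / S.evidence γ u) • S.symbol k := by
  simp only [condMean, Finset.sum_div, Complex.real_smul, Complex.ofReal_div, evidence]
  exact Finset.sum_congr rfl fun k _ => by ring

theorem symbol_sub_condMean (γ : ℝ) (j : Fin M) (u : ℂ) :
    S.symbol j - S.condMean γ u =
      ∑ k, (S.kernel γ k u / S.evidence γ u) • (S.symbol j - S.symbol k) := by
  simp only [smul_sub, Finset.sum_sub_distrib, ← Finset.sum_smul, S.sum_posterior j, one_smul,
    condMean_eq]

theorem continuous_condMean (j : Fin M) (γ : ℝ) : Continuous (S.condMean γ) := by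
  have h : S.condMean γ = fun u => ∑ k, (S.kernel γ k u / S.evidence γ u) • S.symbol k :=
    funext (S.condMean_eq γ)
  rw [h]
  refine continuous_finsetSum _ fun k _ => ?_
  have hk : Continuous fun u => S.kernel γ k u / S.evidence γ u :=
    (S.continuous_kernel γ k).div (S.continuous_evidence γ) fun u => (S.evidence_pos j γ u).ne'
  fun_prop

/-- The conditional square error, weighted by the likelihood, is dominated by overlaps. -/
theorem sqError_mul_kernel_le (hγ : 0 ≤ γ) (j : Fin M) (u : ℂ) :
    ‖S.symbol j - S.condMean γ u‖ ^ 2 * S.kernel γ j u ≤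
      ∑ k, ‖S.symbol j - S.symbol k‖ ^ 2 * S.overlap γ j k u := by
  -- Jensen's inequality for the squared norm, with the posterior probabilities as weights.
  have hconv : ConvexOn ℝ univ fun z : ℂ => ‖z‖ ^ 2 :=
    (convexOn_univ_norm (E := ℂ)).pow (fun _ _ => norm_nonneg _) 2
  have hj := hconv.map_sum_le (t := Finset.univ)
    (w := fun k => S.kernel γ k u / S.evidence γ u) (p := fun k => S.symbol j - S.symbol k)
    (fun k _ => div_nonneg (S.kernel_pos γ k u).le (S.evidence_pos j γ u).le)
    (S.sum_posterior j γ u) (fun _ _ => mem_univ _)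
  rw [← S.symbol_sub_condMean] at hj
  refine (mul_le_mul_of_nonneg_right hj (S.kernel_pos γ j u).le).trans ?_
  rw [Finset.sum_mul]
  refine Finset.sum_le_sum fun k _ => ?_
  have := mul_le_mul_of_nonneg_left (S.kernel_mul_le_overlap hγ j k u)
    (sq_nonneg ‖S.symbol j - S.symbol k‖)
  simp only [smul_eq_mul]
  linarith

theorem integrable_sum_overlap (γ : ℝ) (j : Fin M) :
    Integrable fun u => ∑ k, ‖S.symbol j - S.symbol k‖ ^ 2 * S.overlap γ j k u :=
  integrable_finsetSum _ fun k _ => (S.integrable_overlap γ j k).const_mul _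

theorem integrable_sqError (hγ : 0 ≤ γ) (j : Fin M) :
    Integrable fun u => ‖S.symbol j - S.condMean γ u‖ ^ 2 * S.kernel γ j u := by
  refine (S.integrable_sum_overlap γ j).mono' ?_ (ae_of_all _ fun u => ?_)
  · exact ((((continuous_const.sub (S.continuous_condMean j γ)).norm.pow 2).mul
      (S.continuous_kernel γ j))).aestronglyMeasurable
  · rw [Real.norm_of_nonneg (mul_nonneg (sq_nonneg _) (S.kernel_pos γ j u).le)]
    exact S.sqError_mul_kernel_le hγ j u

theorem mmse_nonneg (γ : ℝ) : 0 ≤ S.mmse γ := by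
  unfold mmse
  refine mul_nonneg (by positivity) (Finset.sum_nonneg fun j _ => integral_nonneg fun u => ?_)
  exact mul_nonneg (sq_nonneg _) (S.kernel_pos γ j u).le

theorem mmse_le (hγ : 0 ≤ γ) :
    S.mmse γ ≤ (1 / ((M : ℝ) * Real.pi)) * ∑ j, ∑ k, ‖S.symbol j - S.symbol k‖ ^ 2 *
      (Real.pi * Real.exp (-(γ * (‖S.symbol j - S.symbol k‖ ^ 2 / 4)))) := by
  unfold mmse
  refine mul_le_mul_of_nonneg_left (Finset.sum_le_sum fun j _ => ?_) (by positivity)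
  refine (integral_mono (S.integrable_sqError hγ j) (S.integrable_sum_overlap γ j)
    (S.sqError_mul_kernel_le hγ j)).trans_eq ?_
  rw [integral_finsetSum _ fun k _ => (S.integrable_overlap γ j k).const_mul _]
  simp only [integral_const_mul, integral_overlap]

/-- The conditional mean cannot equal two distinct symbols at once, so the summed integrand is
positive at every output `u`. -/
theorem mmse_pos (hM : 2 ≤ M) (hγ : 0 ≤ γ) : 0 < S.mmse γ := by
  have hM0 : (0 : ℝ) < M := by positivity
  unfold mmse
  refine mul_pos (by positivity) ?_
  rw [← integral_finsetSum _ fun j _ => S.integrable_sqError hγ j]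
  have hnn : ∀ u j, 0 ≤ ‖S.symbol j - S.condMean γ u‖ ^ 2 * S.kernel γ j u := fun u j =>
    mul_nonneg (sq_nonneg _) (S.kernel_pos γ j u).le
  rw [integral_pos_iff_support_of_nonneg (fun u => Finset.sum_nonneg fun j _ => hnn u j)
    (integrable_finsetSum _ fun j _ => S.integrable_sqError hγ j)]
  have : Function.support (fun u => ∑ j, ‖S.symbol j - S.condMean γ u‖ ^ 2 * S.kernel γ j u) =
      univ := by
    refine eq_univ_of_forall fun u hu => ?_
    rw [Finset.sum_eq_zero_iff_of_nonneg fun j _ => hnn u j] at hu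
    have key : ∀ j, S.symbol j = S.condMean γ u := fun j => by
      have := hu j (Finset.mem_univ j)
      simpa [(S.kernel_pos γ j u).ne', sub_eq_zero] using this
    have h01 : (⟨0, by omega⟩ : Fin M) = ⟨1, by omega⟩ :=
      S.symbol_injective ((key _).trans (key _).symm)
    simp at h01
  rw [this]
  simp

/-! ### Equivocation -/

/-- Passing to `(1 + ∑ y)²` makes the bound linear in `y`, where `y²` will be a likelihood ratio.
The cruder `log (1 + x) ≤ x` would leave a sum of whole kernels, whose integrals do not decay in
`γ`. -/
theorem log_one_add_sum_le {ι : Type*} (s : Finset ι) (y : ι → ℝ) (hy : ∀ i ∈ s, 0 ≤ y i) :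
    Real.log (1 + ∑ i ∈ s, y i ^ 2) ≤ 2 * ∑ i ∈ s, y i := by
  have h0 : 0 ≤ ∑ i ∈ s, y i := Finset.sum_nonneg hy
  have h1 : 1 + ∑ i ∈ s, y i ^ 2 ≤ (1 + ∑ i ∈ s, y i) ^ 2 := by
    have := Finset.sum_sq_le_sq_sum_of_nonneg hy
    nlinarith
  have hp : 0 < 1 + ∑ i ∈ s, y i ^ 2 :=
    add_pos_of_pos_of_nonneg one_pos (Finset.sum_nonneg fun i _ => sq_nonneg _)
  calc Real.log (1 + ∑ i ∈ s, y i ^ 2) ≤ Real.log ((1 + ∑ i ∈ s, y i) ^ 2) :=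
        Real.log_le_log hp h1
    _ = 2 * Real.log (1 + ∑ i ∈ s, y i) := by rw [Real.log_pow]; norm_num
    _ ≤ 2 * ∑ i ∈ s, y i := by
        have := Real.log_le_sub_one_of_pos (by linarith : 0 < 1 + ∑ i ∈ s, y i)
        linarith

theorem kernel_mul_log_ratio_nonneg (γ : ℝ) (j : Fin M) (u : ℂ) :
    0 ≤ S.kernel γ j u * Real.log (S.evidence γ u / S.kernel γ j u) :=
  mul_nonneg (S.kernel_pos γ j u).le (Real.log_nonneg
    ((one_le_div (S.kernel_pos γ j u)).2 (S.kernel_le_evidence γ j u)))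

theorem kernel_mul_log_ratio_le (hγ : 0 ≤ γ) (j : Fin M) (u : ℂ) :
    S.kernel γ j u * Real.log (S.evidence γ u / S.kernel γ j u) ≤
      ∑ k ∈ Finset.univ.erase j, 2 * S.overlap γ j k u := by
  have hj := S.kernel_pos γ j u
  -- Each ratio of kernels is the square of overlap over kernel, the form required by
  -- `log_one_add_sum_le`.
  have h : S.evidence γ u / S.kernel γ j u =
      1 + ∑ k ∈ Finset.univ.erase j, (S.overlap γ j k u / S.kernel γ j u) ^ 2 := by
    rw [evidence, ← Finset.add_sum_erase _ _ (Finset.mem_univ j), add_div, div_self hj.ne',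
      Finset.sum_div]
    congr 1
    refine Finset.sum_congr rfl fun k _ => ?_
    rw [div_pow, S.overlap_sq hγ]
    field_simp
  rw [h]
  refine (mul_le_mul_of_nonneg_left (log_one_add_sum_le _ _ fun k _ =>
    div_nonneg (S.overlap_pos γ j k u).le hj.le) hj.le).trans_eq ?_
  rw [← Finset.sum_div, ← Finset.mul_sum]
  field_simp

theorem integrable_kernel_mul_log_ratio (hγ : 0 ≤ γ) (j : Fin M) :
    Integrable fun u => S.kernel γ j u * Real.log (S.evidence γ u / S.kernel γ j u) := by
  refine (integrable_finsetSum (Finset.univ.erase j) fun k _ =>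
    (S.integrable_overlap γ j k).const_mul 2).mono' ?_ (ae_of_all _ fun u => ?_)
  · refine Continuous.aestronglyMeasurable ((S.continuous_kernel γ j).mul (Continuous.log
      ((S.continuous_evidence γ).div (S.continuous_kernel γ j)
        fun u => (S.kernel_pos γ j u).ne') fun u =>
          (div_pos (S.evidence_pos j γ u) (S.kernel_pos γ j u)).ne'))
  · rw [Real.norm_of_nonneg (S.kernel_mul_log_ratio_nonneg γ j u)]
    exact S.kernel_mul_log_ratio_le hγ j u

/-- This is the entropy of the noise: its `-π` per symbol cancels the `1 / e` inside `log₂ (M / e)`.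
-/
theorem integral_kernel_mul_log_kernel (γ : ℝ) (j : Fin M) :
    Integrable (fun u => S.kernel γ j u * Real.log (S.kernel γ j u)) ∧
      ∫ u, S.kernel γ j u * Real.log (S.kernel γ j u) = -Real.pi := by
  have h : (fun u => S.kernel γ j u * Real.log (S.kernel γ j u)) = fun u : ℂ =>
      (fun w : ℂ => -(‖w‖ ^ 2 * Real.exp (-‖w‖ ^ 2)))
        (u - (Real.sqrt γ : ℂ) * S.symbol j) := by
    funext u
    simp only [kernel, Real.log_exp]
    ring
  rw [h]
  refine ⟨integrable_norm_sq_mul_exp.neg.comp_sub_right _, ?_⟩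
  rw [integral_sub_right_eq_self (fun w : ℂ => -(‖w‖ ^ 2 * Real.exp (-‖w‖ ^ 2))), integral_neg,
    integral_norm_sq_mul_exp]

theorem kernel_mul_log_evidence (γ : ℝ) (j : Fin M) (u : ℂ) :
    S.kernel γ j u * Real.log (S.evidence γ u) = S.kernel γ j u * Real.log (S.kernel γ j u) +
      S.kernel γ j u * Real.log (S.evidence γ u / S.kernel γ j u) := by
  rw [Real.log_div (S.evidence_pos j γ u).ne' (S.kernel_pos γ j u).ne']
  ring

theorem integrable_kernel_mul_log_evidence (hγ : 0 ≤ γ) (j : Fin M) :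
    Integrable fun u => S.kernel γ j u * Real.log (S.evidence γ u) := by
  simp only [S.kernel_mul_log_evidence γ j]
  exact (S.integral_kernel_mul_log_kernel γ j).1.add (S.integrable_kernel_mul_log_ratio hγ j)

theorem lossIntegral_eq (γ : ℝ) :
    S.lossIntegral γ = (1 / ((M : ℝ) * Real.pi)) / Real.log 2 *
      ∑ j, ∫ u : ℂ, S.kernel γ j u * Real.log (S.evidence γ u) := by
  simp only [lossIntegral, Real.logb, mul_div_assoc', integral_div, ← Finset.sum_div, evidence]
  ring

/-- The equivocation `H(s | y)` in bits is an average of likelihood-weighted log-ratios. -/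
theorem logb_sub_mutualInfo (hM : 2 ≤ M) (hγ : 0 ≤ γ) :
    Real.logb 2 M - S.mutualInfo γ = (1 / ((M : ℝ) * Real.pi)) / Real.log 2 *
      ∑ j, ∫ u : ℂ, S.kernel γ j u * Real.log (S.evidence γ u / S.kernel γ j u) := by
  have hM0 : (M : ℝ) ≠ 0 := by positivity
  have hl : Real.log 2 ≠ 0 := (Real.log_pos one_lt_two).ne'
  have h : ∀ j, ∫ u : ℂ, S.kernel γ j u * Real.log (S.evidence γ u) = -Real.pi +
      ∫ u : ℂ, S.kernel γ j u * Real.log (S.evidence γ u / S.kernel γ j u) := fun j => by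
    simp only [S.kernel_mul_log_evidence γ j]
    rw [integral_add (S.integral_kernel_mul_log_kernel γ j).1
      (S.integrable_kernel_mul_log_ratio hγ j), (S.integral_kernel_mul_log_kernel γ j).2]
  rw [mutualInfo, lossIntegral_eq, Real.logb_div hM0 (Real.exp_ne_zero _)]
  simp only [h, Finset.sum_add_distrib, Finset.sum_const, Finset.card_univ, Fintype.card_fin,
    nsmul_eq_mul, Real.logb, Real.log_exp]
  have hpi := Real.pi_ne_zero
  field_simp
  ring

theorem mutualInfo_le (hM : 2 ≤ M) (hγ : 0 ≤ γ) : S.mutualInfo γ ≤ Real.logb 2 M := by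
  have hl := Real.log_pos one_lt_two
  rw [← sub_nonneg, S.logb_sub_mutualInfo hM hγ]
  refine mul_nonneg (by positivity) (Finset.sum_nonneg fun j _ => integral_nonneg fun u => ?_)
  exact S.kernel_mul_log_ratio_nonneg γ j u

theorem logb_sub_mutualInfo_le (hM : 2 ≤ M) (hγ : 0 ≤ γ) :
    Real.logb 2 M - S.mutualInfo γ ≤ (1 / ((M : ℝ) * Real.pi)) / Real.log 2 *
      ∑ j, ∑ k ∈ Finset.univ.erase j,
        2 * (Real.pi * Real.exp (-(γ * (‖S.symbol j - S.symbol k‖ ^ 2 / 4)))) := by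
  have hl := Real.log_pos one_lt_two
  rw [S.logb_sub_mutualInfo hM hγ]
  refine mul_le_mul_of_nonneg_left (Finset.sum_le_sum fun j _ => ?_) (by positivity)
  refine (integral_mono (S.integrable_kernel_mul_log_ratio hγ j)
    (integrable_finsetSum (Finset.univ.erase j) fun k _ =>
      (S.integrable_overlap γ j k).const_mul 2) (S.kernel_mul_log_ratio_le hγ j)).trans_eq ?_
  rw [integral_finsetSum _ fun k _ => (S.integrable_overlap γ j k).const_mul _]
  simp only [integral_const_mul, integral_overlap]

/-- With the diagonal `k = j` removed, distinctness of the symbols makes every exponential rate in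
the equivocation bound positive. -/
theorem tendsto_mutualInfo (hM : 2 ≤ M) :
    Tendsto S.mutualInfo atTop (𝓝 (Real.logb 2 M)) := by
  have hlim : Tendsto (fun γ : ℝ => (1 / ((M : ℝ) * Real.pi)) / Real.log 2 *
      ∑ j, ∑ k ∈ Finset.univ.erase j,
        2 * (Real.pi * Real.exp (-(γ * (‖S.symbol j - S.symbol k‖ ^ 2 / 4))))) atTop
      (𝓝 ((1 / ((M : ℝ) * Real.pi)) / Real.log 2 *
        ∑ j : Fin M, ∑ _k ∈ Finset.univ.erase j, 2 * (Real.pi * 0))) := by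
    refine Tendsto.const_mul _ (tendsto_finsetSum _ fun j _ => tendsto_finsetSum _ fun k hk => ?_)
    refine Tendsto.const_mul _ (Tendsto.const_mul _ ?_)
    have hne : S.symbol j - S.symbol k ≠ 0 := by
      rw [sub_ne_zero]
      exact fun h => (Finset.ne_of_mem_erase hk) (S.symbol_injective h).symm
    exact Real.tendsto_exp_neg_atTop_nhds_zero.comp
      (tendsto_id.atTop_mul_const (by positivity))
  have h0 : Tendsto (fun γ => Real.logb 2 M - S.mutualInfo γ) atTop (𝓝 0) := by
    simp only [mul_zero, Finset.sum_const_zero] at hlim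
    refine tendsto_of_tendsto_of_tendsto_of_le_of_le' tendsto_const_nhds hlim ?_ ?_
    · filter_upwards [eventually_ge_atTop 0] with γ hγ
      exact sub_nonneg.2 (S.mutualInfo_le hM hγ)
    · filter_upwards [eventually_ge_atTop 0] with γ hγ
      exact S.logb_sub_mutualInfo_le hM hγ
  simpa using (tendsto_const_nhds (x := Real.logb 2 (M : ℝ))).sub h0

end

end Constellation

end Wiretap

namespace Wiretap

/-! ### Differentiating a Gaussian average of a log-sum-exp -/

section LogSumExp

variable {ι : Type*} [Fintype ι]

theorem hasDerivAt_log_sum_exp [Nonempty ι] (d : ι → ℂ) (w : ℂ) (r : ℝ) :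
    HasDerivAt (fun r : ℝ => Real.log (∑ k, Real.exp (-‖w + r • d k‖ ^ 2)))
      (-(2 * ∑ k, Real.exp (-‖w + r • d k‖ ^ 2) / (∑ i, Real.exp (-‖w + r • d i‖ ^ 2)) *
        inner ℝ (w + r • d k) (d k))) r := by
  have hE : 0 < ∑ i, Real.exp (-‖w + r • d i‖ ^ 2) :=
    Finset.sum_pos (fun i _ => Real.exp_pos _) Finset.univ_nonempty
  have h : ∀ k, HasDerivAt (fun r : ℝ => Real.exp (-‖w + r • d k‖ ^ 2))
      (Real.exp (-‖w + r • d k‖ ^ 2) * -(2 * inner ℝ (w + r • d k) (d k))) r := fun k => by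
    have h1 : HasDerivAt (fun r : ℝ => w + r • d k) (d k) r := by
      simpa using ((hasDerivAt_id r).smul_const (d k)).const_add w
    exact h1.norm_sq.neg.exp
  have hs := (HasDerivAt.fun_sum fun k (_ : k ∈ Finset.univ) => h k).log hE.ne'
  convert hs using 1
  rw [Finset.sum_div, Finset.mul_sum, ← Finset.sum_neg_distrib]
  exact Finset.sum_congr rfl fun k _ => by ring

/-- The softmax weights sum to one, so the derivative grows at most linearly in `w`, uniformly for
`r` in a bounded set. -/
theorem norm_deriv_log_sum_exp_le [Nonempty ι] (d : ι → ℂ) {D R : ℝ} (hD : ∀ k, ‖d k‖ ≤ D)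
    (w : ℂ) {r : ℝ} (hr : |r| ≤ R) :
    ‖-(2 * ∑ k, Real.exp (-‖w + r • d k‖ ^ 2) / (∑ i, Real.exp (-‖w + r • d i‖ ^ 2)) *
        inner ℝ (w + r • d k) (d k))‖ ≤ 2 * ((‖w‖ + R * D) * D) := by
  have hE : 0 < ∑ i, Real.exp (-‖w + r • d i‖ ^ 2) :=
    Finset.sum_pos (fun i _ => Real.exp_pos _) Finset.univ_nonempty
  rw [norm_neg, norm_mul, Real.norm_two]
  refine mul_le_mul_of_nonneg_left ((norm_sum_le _ _).trans ?_) two_pos.le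
  have h1 : (‖w‖ + R * D) * D = ∑ k, Real.exp (-‖w + r • d k‖ ^ 2) /
      (∑ i, Real.exp (-‖w + r • d i‖ ^ 2)) * ((‖w‖ + R * D) * D) := by
    rw [← Finset.sum_mul, ← Finset.sum_div, div_self hE.ne', one_mul]
  rw [h1]
  refine Finset.sum_le_sum fun k _ => ?_
  rw [norm_mul, Real.norm_of_nonneg (by positivity)]
  refine mul_le_mul_of_nonneg_left ((norm_inner_le_norm _ _).trans ?_) (by positivity)
  have hD0 := (norm_nonneg _).trans (hD k)
  have hR0 := (abs_nonneg _).trans hr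
  have h2 : ‖w + r • d k‖ ≤ ‖w‖ + R * D := by
    refine (norm_add_le _ _).trans (add_le_add_right ?_ _)
    rw [norm_smul, Real.norm_eq_abs]
    exact mul_le_mul hr (hD k) (norm_nonneg _) hR0
  exact mul_le_mul h2 (hD k) (norm_nonneg _) (by positivity)

theorem hasDerivAt_integral_log_sum_exp [Nonempty ι] (d : ι → ℂ) (r₀ : ℝ)
    (hint : Integrable fun w : ℂ =>
      Real.exp (-‖w‖ ^ 2) * Real.log (∑ k, Real.exp (-‖w + r₀ • d k‖ ^ 2))) :
    Integrable (fun w : ℂ => Real.exp (-‖w‖ ^ 2) *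
      -(2 * ∑ k, Real.exp (-‖w + r₀ • d k‖ ^ 2) / (∑ i, Real.exp (-‖w + r₀ • d i‖ ^ 2)) *
        inner ℝ (w + r₀ • d k) (d k))) ∧
    HasDerivAt (fun r : ℝ => ∫ w : ℂ,
        Real.exp (-‖w‖ ^ 2) * Real.log (∑ k, Real.exp (-‖w + r • d k‖ ^ 2)))
      (∫ w : ℂ, Real.exp (-‖w‖ ^ 2) *
        -(2 * ∑ k, Real.exp (-‖w + r₀ • d k‖ ^ 2) / (∑ i, Real.exp (-‖w + r₀ • d i‖ ^ 2)) *
          inner ℝ (w + r₀ • d k) (d k))) r₀ := by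
  set D : ℝ := ∑ k, ‖d k‖
  have hD : ∀ k, ‖d k‖ ≤ D := fun k =>
    Finset.single_le_sum (f := fun k => ‖d k‖) (fun _ _ => norm_nonneg _) (Finset.mem_univ k)
  have hD0 : 0 ≤ D := Finset.sum_nonneg fun _ _ => norm_nonneg _
  have hE : ∀ (r : ℝ) (w : ℂ), ∑ i, Real.exp (-‖w + r • d i‖ ^ 2) ≠ 0 := fun r w =>
    (Finset.sum_pos (fun i _ => Real.exp_pos _) Finset.univ_nonempty).ne'
  have hEc : ∀ r : ℝ, Continuous fun w : ℂ => ∑ i, Real.exp (-‖w + r • d i‖ ^ 2) := fun r => by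
    fun_prop
  refine hasDerivAt_integral_of_dominated_loc_of_deriv_le (μ := volume)
    (F := fun (r : ℝ) (w : ℂ) =>
      Real.exp (-‖w‖ ^ 2) * Real.log (∑ k, Real.exp (-‖w + r • d k‖ ^ 2)))
    (F' := fun (r : ℝ) (w : ℂ) => Real.exp (-‖w‖ ^ 2) *
      -(2 * ∑ k, Real.exp (-‖w + r • d k‖ ^ 2) / (∑ i, Real.exp (-‖w + r • d i‖ ^ 2)) *
        inner ℝ (w + r • d k) (d k)))
    -- On the unit ball about `r₀` one may take `R = |r₀| + 1`; the linear term is absorbed by `2 D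
    -- ‖w‖ ≤ 1 + D² ‖w‖²`, leaving two known Gaussian moments.
    (bound := fun w : ℂ => (1 + 2 * (|r₀| + 1) * D * D) * Real.exp (-‖w‖ ^ 2) +
      D ^ 2 * (‖w‖ ^ 2 * Real.exp (-‖w‖ ^ 2)))
    (Metric.ball_mem_nhds r₀ one_pos) ?_ hint ?_ ?_ ?_ ?_
  · refine Eventually.of_forall fun r => Continuous.aestronglyMeasurable ?_
    exact Continuous.mul (by fun_prop) ((hEc r).log (hE r))
  · refine Continuous.aestronglyMeasurable (Continuous.mul (by fun_prop) ?_)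
    refine (continuous_const.mul (continuous_finsetSum _ fun k _ => ?_)).neg
    refine Continuous.mul (Continuous.div (by fun_prop) (hEc r₀) (hE r₀)) ?_
    fun_prop
  · refine ae_of_all _ fun w r hr => ?_
    have hr1 : |r| ≤ |r₀| + 1 := by
      have h1 : |r - r₀| < 1 := by simpa [Real.dist_eq] using hr
      have h2 := abs_sub_abs_le_abs_sub r r₀
      linarith
    rw [norm_mul, Real.norm_of_nonneg (Real.exp_pos _).le]
    refine (mul_le_mul_of_nonneg_left (norm_deriv_log_sum_exp_le d hD w hr1)
      (Real.exp_pos _).le).trans ?_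
    have hx := (Real.exp_pos (-‖w‖ ^ 2)).le
    nlinarith [mul_nonneg hx (sq_nonneg (D * ‖w‖ - 1))]
  · exact (integrable_exp_neg_norm_sq.const_mul _).add (integrable_norm_sq_mul_exp.const_mul _)
  · exact ae_of_all _ fun w r _ => (hasDerivAt_log_sum_exp d w r).const_mul _

/-- A variance identity: the weighted average of `⟪u - r s_k, s_j - s_k⟫` is `r` times the weighted
variance, whatever the value of `u`. -/
theorem sum_sum_inner_eq_variance (p : ι → ℝ) (hp : ∑ k, p k = 1) (s : ι → ℂ) (u : ℂ) (r : ℝ) :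
    ∑ j, p j * ∑ k, p k * inner ℝ (u - r • s k) (s j - s k) =
      r * ∑ j, p j * ‖s j - ∑ k, p k • s k‖ ^ 2 := by
  set m : ℂ := ∑ k, p k • s k with hm
  have hc : ∀ k, ∑ j, p j • (s j - s k) = m - s k := fun k => by
    simp only [smul_sub, Finset.sum_sub_distrib, ← Finset.sum_smul, hp, one_smul, hm]
  have hz : ∑ k, p k • (m - s k) = 0 := by
    simp only [smul_sub, Finset.sum_sub_distrib, ← Finset.sum_smul, hp, one_smul, hm, sub_self]
  have h1 : ∑ j, p j * ∑ k, p k * inner ℝ (u - r • s k) (s j - s k) =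
      ∑ k, p k * inner ℝ (u - r • s k) (m - s k) := by
    simp only [Finset.mul_sum]
    rw [Finset.sum_comm]
    refine Finset.sum_congr rfl fun k _ => ?_
    rw [← hc k, inner_sum, Finset.mul_sum]
    refine Finset.sum_congr rfl fun j _ => ?_
    rw [real_inner_smul_right]
    ring
  -- Recentre at the mean `m`: the part `u - r • m` does not depend on `k` and averages to zero
  -- against `m - s k`.
  have h2 : ∀ k, inner ℝ (u - r • s k) (m - s k) =
      inner ℝ (u - r • m) (m - s k) + r * ‖s k - m‖ ^ 2 := fun k => by
    have : u - r • s k = (u - r • m) + r • (m - s k) := by rw [smul_sub]; abel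
    rw [this, inner_add_left, real_inner_smul_left, real_inner_self_eq_norm_sq, norm_sub_rev]
  have h3 : ∑ k, p k * inner ℝ (u - r • m) (m - s k) = 0 := by
    simp only [← real_inner_smul_right]
    rw [← inner_sum, hz, inner_zero_right]
  rw [h1]
  simp only [h2, mul_add, Finset.sum_add_distrib, h3, zero_add, Finset.mul_sum]
  exact Finset.sum_congr rfl fun k _ => by ring

end LogSumExp

/-! ### The derivative of the mutual information -/

namespace Constellation

noncomputable section

variable {M : ℕ} (S : Constellation M) {γ : ℝ}

theorem kernel_add (γ : ℝ) (j k : Fin M) (w : ℂ) :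
    S.kernel γ k (w + (Real.sqrt γ : ℂ) * S.symbol j) =
      Real.exp (-‖w + Real.sqrt γ • (S.symbol j - S.symbol k)‖ ^ 2) := by
  rw [kernel, Complex.real_smul]
  congr 4
  ring

theorem kernel_add_self (γ : ℝ) (j : Fin M) (w : ℂ) :
    S.kernel γ j (w + (Real.sqrt γ : ℂ) * S.symbol j) = Real.exp (-‖w‖ ^ 2) := by
  simp [kernel_add]

/-- The translation makes the Gaussian weight independent of `γ`, so that only the logarithm has to
be differentiated. -/
theorem integral_kernel_mul_log_evidence (γ : ℝ) (j : Fin M) :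
    ∫ u : ℂ, S.kernel γ j u * Real.log (S.evidence γ u) =
      ∫ w : ℂ, Real.exp (-‖w‖ ^ 2) * Real.log (∑ k,
        Real.exp (-‖w + Real.sqrt γ • (S.symbol j - S.symbol k)‖ ^ 2)) := by
  rw [← integral_add_right_eq_self _ ((Real.sqrt γ : ℂ) * S.symbol j)]
  simp only [evidence, kernel_add_self, kernel_add]

/-- Summed over the transmitted symbol, the derivative of the loss integrand in `√γ` is a multiple
of the conditional square error. -/
theorem sum_kernel_mul_inner (hM : 2 ≤ M) (γ r : ℝ) (u : ℂ) :
    ∑ j, S.kernel γ j u * -(2 * ∑ k, S.kernel γ k u / S.evidence γ u *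
        inner ℝ (u - r • S.symbol k) (S.symbol j - S.symbol k)) =
      -(2 * r) * ∑ j, ‖S.symbol j - S.condMean γ u‖ ^ 2 * S.kernel γ j u := by
  have j₀ : Fin M := ⟨0, by omega⟩
  have hE := S.evidence_pos j₀ γ u
  have h := sum_sum_inner_eq_variance (fun k => S.kernel γ k u / S.evidence γ u)
    (S.sum_posterior j₀ γ u) S.symbol u r
  rw [← S.condMean_eq] at h
  calc _ = -(2 * S.evidence γ u) * ∑ j, S.kernel γ j u / S.evidence γ u *
        ∑ k, S.kernel γ k u / S.evidence γ u *
          inner ℝ (u - r • S.symbol k) (S.symbol j - S.symbol k) := by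
        rw [Finset.mul_sum]
        exact Finset.sum_congr rfl fun j _ => by field_simp
    _ = _ := by
        rw [h, Finset.mul_sum, Finset.mul_sum, Finset.mul_sum]
        exact Finset.sum_congr rfl fun j _ => by field_simp

theorem hasDerivAt_lossIntegral (hM : 2 ≤ M) (hγ : 0 < γ) :
    HasDerivAt S.lossIntegral (-(Real.logb 2 (Real.exp 1) * S.mmse γ)) γ := by
  have hne : Nonempty (Fin M) := ⟨⟨0, by omega⟩⟩
  set r := Real.sqrt γ with hr
  have hr0 : 0 < r := Real.sqrt_pos.2 hγ
  have hint : ∀ j, Integrable fun w : ℂ => Real.exp (-‖w‖ ^ 2) *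
      Real.log (∑ k, Real.exp (-‖w + r • (S.symbol j - S.symbol k)‖ ^ 2)) := fun j => by
    have := (S.integrable_kernel_mul_log_evidence hγ.le j).comp_add_right
      ((Real.sqrt γ : ℂ) * S.symbol j)
    simpa only [evidence, kernel_add_self, kernel_add] using this
  have hder := fun j => hasDerivAt_integral_log_sum_exp
    (fun k => S.symbol j - S.symbol k) r (hint j)
  -- The translation depended on `j`. Undoing it returns all terms to the common output variable
  -- `u`, so the sum over `j` can be taken under one integral.
  have htr : ∀ j, (fun u : ℂ => S.kernel γ j u * -(2 * ∑ k, S.kernel γ k u / S.evidence γ u *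
        inner ℝ (u - r • S.symbol k) (S.symbol j - S.symbol k))) = fun u : ℂ =>
      (fun w : ℂ => Real.exp (-‖w‖ ^ 2) *
        -(2 * ∑ k, Real.exp (-‖w + r • (S.symbol j - S.symbol k)‖ ^ 2) /
          (∑ i, Real.exp (-‖w + r • (S.symbol j - S.symbol i)‖ ^ 2)) *
        inner ℝ (w + r • (S.symbol j - S.symbol k)) (S.symbol j - S.symbol k)))
      (u - (Real.sqrt γ : ℂ) * S.symbol j) := fun j => by
    funext u
    have h1 : ∀ k, u - (Real.sqrt γ : ℂ) * S.symbol j + r • (S.symbol j - S.symbol k) =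
        u - r • S.symbol k := fun k => by
      rw [Complex.real_smul, Complex.real_smul]; ring
    simp only [evidence, kernel, h1]
    simp only [hr, Complex.real_smul]
  have hder' : HasDerivAt (fun r : ℝ => ∑ j, ∫ w : ℂ, Real.exp (-‖w‖ ^ 2) *
      Real.log (∑ k, Real.exp (-‖w + r • (S.symbol j - S.symbol k)‖ ^ 2)))
      (-(2 * r) * ∑ j, ∫ u : ℂ, ‖S.symbol j - S.condMean γ u‖ ^ 2 * S.kernel γ j u) r := by
    refine (HasDerivAt.fun_sum fun j (_ : j ∈ Finset.univ) => (hder j).2).congr_deriv (Eq.symm ?_)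
    have hI : ∀ j ∈ Finset.univ, Integrable fun u : ℂ => S.kernel γ j u *
        -(2 * ∑ k, S.kernel γ k u / S.evidence γ u *
          inner ℝ (u - r • S.symbol k) (S.symbol j - S.symbol k)) := fun j _ => by
      rw [htr]; exact (hder j).1.comp_sub_right _
    calc -(2 * r) * ∑ j, ∫ u : ℂ, ‖S.symbol j - S.condMean γ u‖ ^ 2 * S.kernel γ j u
        = ∫ u : ℂ, ∑ j, S.kernel γ j u * -(2 * ∑ k, S.kernel γ k u / S.evidence γ u *
            inner ℝ (u - r • S.symbol k) (S.symbol j - S.symbol k)) := by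
          rw [← integral_finsetSum _ fun j _ => S.integrable_sqError hγ.le j,
            ← integral_const_mul]
          exact integral_congr_ae (ae_of_all _ fun u => (S.sum_kernel_mul_inner hM γ r u).symm)
      _ = ∑ j, ∫ u : ℂ, S.kernel γ j u * -(2 * ∑ k, S.kernel γ k u / S.evidence γ u *
            inner ℝ (u - r • S.symbol k) (S.symbol j - S.symbol k)) := integral_finsetSum _ hI
      _ = _ := Finset.sum_congr rfl fun j _ => by
          rw [htr]
          exact integral_sub_right_eq_self (fun w : ℂ => Real.exp (-‖w‖ ^ 2) *
            -(2 * ∑ k, Real.exp (-‖w + r • (S.symbol j - S.symbol k)‖ ^ 2) /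
              (∑ i, Real.exp (-‖w + r • (S.symbol j - S.symbol i)‖ ^ 2)) *
            inner ℝ (w + r • (S.symbol j - S.symbol k)) (S.symbol j - S.symbol k))) _
  -- The chain rule factor `1 / (2 √γ)` cancels the `2 r` of the variance identity.
  have hcomp := (hder'.comp γ (Real.hasDerivAt_sqrt hγ.ne')).const_mul
    ((1 / ((M : ℝ) * Real.pi)) / Real.log 2)
  have hfun : S.lossIntegral = fun γ' => (1 / ((M : ℝ) * Real.pi)) / Real.log 2 *
      ((fun r : ℝ => ∑ j, ∫ w : ℂ, Real.exp (-‖w‖ ^ 2) *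
        Real.log (∑ k, Real.exp (-‖w + r • (S.symbol j - S.symbol k)‖ ^ 2))) ∘ Real.sqrt) γ' := by
    funext γ'
    simp only [lossIntegral_eq, integral_kernel_mul_log_evidence, Function.comp]
  rw [hfun]
  refine hcomp.congr_deriv ?_
  rw [mmse, Real.logb, Real.log_exp, ← hr]
  field_simp

/-- The derivative of the mutual information is the minimum mean square error. -/
theorem hasDerivAt_mutualInfo (hM : 2 ≤ M) (hγ : 0 < γ) :
    HasDerivAt S.mutualInfo (Real.logb 2 (Real.exp 1) * S.mmse γ) γ := by
  have h := (S.hasDerivAt_lossIntegral hM hγ).const_sub (Real.logb 2 ((M : ℝ) / Real.exp 1))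
  rwa [neg_neg] at h

end

end Constellation

end Wiretap

namespace Wiretap

/-! ### Mixture Gamma distributions -/

namespace MixtureGamma

noncomputable section

variable {L : ℕ} (P : MixtureGamma L)

theorem pdf_nonneg {x : ℝ} (hx : 0 ≤ x) : 0 ≤ P.pdf x :=
  Finset.sum_nonneg fun l _ =>
    mul_nonneg (mul_nonneg (P.α_nonneg l) (Real.rpow_nonneg hx _)) (Real.exp_pos _).le

theorem integrableOn_component (l : Fin L) :
    IntegrableOn (fun x => P.α l * x ^ (P.β l - 1) * Real.exp (-(P.ζ l * x))) (Ioi 0) := by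
  have h := integrableOn_rpow_mul_exp_neg_mul_rpow (p := 1) (s := P.β l - 1) (b := P.ζ l)
    (by linarith [P.β_pos l]) one_pos (P.ζ_pos l)
  refine (h.const_mul (P.α l)).congr (ae_of_all _ fun x => ?_)
  simp only [Real.rpow_one, neg_mul]
  ring

theorem integrableOn_pdf : IntegrableOn P.pdf (Ioi 0) :=
  integrable_finsetSum _ fun l _ => P.integrableOn_component l

theorem integral_pdf : ∫ x in Ioi (0 : ℝ), P.pdf x = 1 := by
  unfold pdf
  rw [integral_finsetSum _ fun l _ => P.integrableOn_component l]
  refine Eq.trans ?_ P.normalized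
  refine Finset.sum_congr rfl fun l _ => ?_
  simp only [mul_assoc]
  rw [integral_const_mul, Real.integral_rpow_mul_exp_neg_mul_Ioi (P.β_pos l) (P.ζ_pos l),
    one_div, Real.inv_rpow (P.ζ_pos l).le, Real.rpow_neg (P.ζ_pos l).le]
  ring

theorem cdf_nonneg (x : ℝ) : 0 ≤ P.cdf x :=
  setIntegral_nonneg measurableSet_Ioc fun _ ht => P.pdf_nonneg ht.1.le

theorem monotone_cdf : Monotone P.cdf := fun _ _ hxy =>
  setIntegral_mono_set (P.integrableOn_pdf.mono_set Ioc_subset_Ioi_self)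
    ((ae_restrict_iff' measurableSet_Ioc).2 (ae_of_all _ fun _ ht => P.pdf_nonneg ht.1.le))
    (Ioc_subset_Ioc_right hxy).eventuallyLE

theorem cdf_le_one (x : ℝ) : P.cdf x ≤ 1 := by
  rw [← P.integral_pdf]
  exact setIntegral_mono_set P.integrableOn_pdf
    ((ae_restrict_iff' measurableSet_Ioi).2 (ae_of_all _ fun _ ht => P.pdf_nonneg (le_of_lt ht)))
    Ioc_subset_Ioi_self.eventuallyLE

theorem integrableOn_Ioc_rpow (l : Fin L) (x : ℝ) :
    IntegrableOn (fun t : ℝ => t ^ (P.β l - 1)) (Ioc 0 x) := by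
  rcases le_or_gt x 0 with hx | hx
  · simp [Ioc_eq_empty (not_lt.2 hx)]
  · rw [← intervalIntegrable_iff_integrableOn_Ioc_of_le hx.le]
    exact intervalIntegral.intervalIntegrable_rpow' (by linarith [P.β_pos l])

theorem integral_Ioc_rpow (l : Fin L) {x : ℝ} (hx : 0 ≤ x) :
    ∫ t in Ioc 0 x, t ^ (P.β l - 1) = x ^ P.β l / P.β l := by
  have hβ := P.β_pos l
  rw [← intervalIntegral.integral_of_le hx, integral_rpow (Or.inl (by linarith))]
  simp [Real.zero_rpow hβ.ne']

theorem integrableOn_Ioc_powerPart (x : ℝ) :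
    IntegrableOn (fun t => ∑ l, P.α l * t ^ (P.β l - 1)) (Ioc 0 x) :=
  integrable_finsetSum _ fun l _ => (P.integrableOn_Ioc_rpow l x).const_mul _

theorem integral_Ioc_powerPart {x : ℝ} (hx : 0 ≤ x) :
    ∫ t in Ioc 0 x, ∑ l, P.α l * t ^ (P.β l - 1) = ∑ l, P.α l / P.β l * x ^ P.β l := by
  rw [integral_finsetSum _ fun l _ => (P.integrableOn_Ioc_rpow l x).const_mul _]
  refine Finset.sum_congr rfl fun l _ => ?_
  rw [integral_const_mul, P.integral_Ioc_rpow l hx]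
  ring

/-- The distribution function is at most its leading power part. -/
theorem cdf_le_powerSum {x : ℝ} (hx : 0 ≤ x) :
    P.cdf x ≤ ∑ l, P.α l / P.β l * x ^ P.β l := by
  rw [← P.integral_Ioc_powerPart hx]
  refine setIntegral_mono_on (P.integrableOn_pdf.mono_set Ioc_subset_Ioi_self)
    (P.integrableOn_Ioc_powerPart x) measurableSet_Ioc fun t ht => ?_
  refine Finset.sum_le_sum fun l _ => ?_
  refine mul_le_of_le_one_right (mul_nonneg (P.α_nonneg l) (Real.rpow_nonneg ht.1.le _)) ?_
  exact Real.exp_le_one_iff.2 (neg_nonpos.2 (mul_nonneg (P.ζ_pos l).le ht.1.le))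

/-- Up to an exponential factor, the leading power part is a lower bound of the distribution
function. -/
theorem exp_mul_powerSum_le_cdf {x : ℝ} (hx : 0 ≤ x) :
    Real.exp (-((∑ l, P.ζ l) * x)) * ∑ l, P.α l / P.β l * x ^ P.β l ≤ P.cdf x := by
  rw [← P.integral_Ioc_powerPart hx, ← integral_const_mul]
  refine setIntegral_mono_on ((P.integrableOn_Ioc_powerPart x).const_mul _)
    (P.integrableOn_pdf.mono_set Ioc_subset_Ioi_self) measurableSet_Ioc fun t ht => ?_
  rw [Finset.mul_sum]
  refine Finset.sum_le_sum fun l _ => ?_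
  rw [mul_comm]
  refine mul_le_mul_of_nonneg_left (Real.exp_le_exp.2 (neg_le_neg ?_))
    (mul_nonneg (P.α_nonneg l) (Real.rpow_nonneg ht.1.le _))
  exact mul_le_mul (Finset.single_le_sum (fun i _ => (P.ζ_pos i).le) (Finset.mem_univ l)) ht.2
    ht.1.le (Finset.sum_nonneg fun i _ => (P.ζ_pos i).le)

/-- If the leading power sum vanished at a single positive point, all `α_l` would be zero, against
the normalisation. -/
theorem cdf_pos {x : ℝ} (hx : 0 < x) : 0 < P.cdf x := by
  refine lt_of_lt_of_le (mul_pos (Real.exp_pos _) ?_) (P.exp_mul_powerSum_le_cdf hx.le)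
  have hnn : ∀ l ∈ Finset.univ, 0 ≤ P.α l / P.β l * x ^ P.β l := fun l _ =>
    mul_nonneg (div_nonneg (P.α_nonneg l) (P.β_pos l).le) (Real.rpow_nonneg hx.le _)
  refine (Finset.sum_nonneg hnn).lt_of_ne' fun h0 => ?_
  rw [Finset.sum_eq_zero_iff_of_nonneg hnn] at h0
  have hα : ∀ l, P.α l = 0 := fun l => by
    have := h0 l (Finset.mem_univ l)
    simpa [(P.β_pos l).ne', (Real.rpow_pos_of_pos hx _).ne'] using this
  have hn := P.normalized
  simp [hα] at hn

end

end MixtureGamma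

/-! ### Layer-cake form of expectations -/

/-- Fubini on the region `0 < y < t`. It serves twice: with `f` the density of the main channel,
then with that of the eavesdropper. -/
theorem integral_mul_integral_Ioi {f h : ℝ → ℝ} (hf : IntegrableOn f (Ioi 0))
    (hh : IntegrableOn h (Ioi 0)) :
    IntegrableOn (fun y => f y * ∫ t in Ioi y, h t) (Ioi 0) ∧
      ∫ y in Ioi (0 : ℝ), f y * ∫ t in Ioi y, h t =
        ∫ t in Ioi (0 : ℝ), h t * ∫ y in Ioc 0 t, f y := by
  set F : ℝ × ℝ → ℝ := {p : ℝ × ℝ | p.1 < p.2}.indicator fun p => f p.1 * h p.2 with hFdef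
  have hF : Integrable F ((volume.restrict (Ioi 0)).prod (volume.restrict (Ioi 0))) :=
    (hf.mul_prod hh).indicator (measurableSet_lt measurable_fst measurable_snd)
  have h1 : ∀ y ∈ Ioi (0 : ℝ), ∫ t in Ioi (0 : ℝ), F (y, t) = f y * ∫ t in Ioi y, h t := by
    intro y hy
    have : (fun t => F (y, t)) = (Ioi y).indicator fun t => f y * h t := by
      funext t
      simp [hFdef, indicator_apply]
    rw [this, setIntegral_indicator measurableSet_Ioi, Ioi_inter_Ioi, max_eq_right (le_of_lt hy),
      integral_const_mul]
  have h2 : ∀ t ∈ Ioi (0 : ℝ), ∫ y in Ioi (0 : ℝ), F (y, t) = h t * ∫ y in Ioc 0 t, f y := by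
    intro t _
    have : (fun y => F (y, t)) = (Iio t).indicator fun y => h t * f y := by
      funext y
      simp [hFdef, indicator_apply, mul_comm]
    rw [this, setIntegral_indicator measurableSet_Iio, Ioi_inter_Iio, integral_const_mul,
      integral_Ioc_eq_integral_Ioo]
  refine ⟨hF.integral_prod_left.congr
    ((ae_restrict_iff' measurableSet_Ioi).2 (ae_of_all _ h1)), ?_⟩
  rw [← setIntegral_congr_fun measurableSet_Ioi h1, ← setIntegral_congr_fun measurableSet_Ioi h2]
  exact integral_integral_swap (f := fun y t => F (y, t)) hF

/-! ### Mutual information as an integral of the minimum mean square error -/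

namespace Constellation

noncomputable section

variable {M : ℕ} (S : Constellation M) {γ : ℝ}

theorem logb_exp_one_pos : 0 < Real.logb 2 (Real.exp 1) :=
  Real.logb_pos one_lt_two (Real.one_lt_exp_iff.2 one_pos)

/-- On `(0, ∞)` the MMSE is a constant multiple of a derivative, and `deriv` of any real function is
measurable. -/
theorem aestronglyMeasurable_mmse (hM : 2 ≤ M) :
    AEStronglyMeasurable S.mmse (volume.restrict (Ioi 0)) := by
  have h : AEStronglyMeasurable (fun γ => (Real.logb 2 (Real.exp 1))⁻¹ * deriv S.mutualInfo γ)
      (volume.restrict (Ioi 0)) :=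
    ((measurable_deriv S.mutualInfo).const_mul _).aestronglyMeasurable
  refine h.congr ((ae_restrict_iff' measurableSet_Ioi).2 (ae_of_all _ fun γ hγ => ?_))
  have hpos := logb_exp_one_pos
  simp only [(S.hasDerivAt_mutualInfo hM hγ).deriv]
  field_simp

/-- All moments of the minimum mean square error of order above `-1` converge. -/
theorem integrableOn_rpow_mul_mmse (hM : 2 ≤ M) {s : ℝ} (hs : -1 < s) :
    IntegrableOn (fun γ => γ ^ s * S.mmse γ) (Ioi 0) := by
  have hbound : IntegrableOn (fun γ : ℝ => (1 / ((M : ℝ) * Real.pi)) * ∑ j, ∑ k,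
      ‖S.symbol j - S.symbol k‖ ^ 2 * (Real.pi * (γ ^ s *
        Real.exp (-(‖S.symbol j - S.symbol k‖ ^ 2 / 4) * γ ^ (1 : ℝ))))) (Ioi 0) := by
    refine Integrable.const_mul (integrable_finsetSum _ fun j _ =>
      integrable_finsetSum _ fun k _ => ?_) _
    -- The diagonal terms have no exponential decay, but their coefficient `‖s_j - s_j‖²` is zero.
    rcases eq_or_ne j k with rfl | hjk
    · simp
    · have hne : S.symbol j - S.symbol k ≠ 0 := sub_ne_zero.2 (S.symbol_injective.ne hjk)
      exact ((integrableOn_rpow_mul_exp_neg_mul_rpow hs one_pos (by positivity)).const_mul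
        _).const_mul _
  refine Integrable.mono' hbound ?_ ((ae_restrict_iff' measurableSet_Ioi).2
    (ae_of_all _ fun γ hγ => ?_))
  · exact (measurable_id.pow_const s).aestronglyMeasurable.mul (S.aestronglyMeasurable_mmse hM)
  · have hγ0 : (0 : ℝ) ≤ γ := le_of_lt hγ
    have hp := Real.rpow_nonneg hγ0 s
    rw [Real.norm_of_nonneg (mul_nonneg hp (S.mmse_nonneg γ))]
    refine (mul_le_mul_of_nonneg_left (S.mmse_le hγ0) hp).trans_eq ?_
    simp only [Finset.mul_sum, Real.rpow_one]
    refine Finset.sum_congr rfl fun j _ => Finset.sum_congr rfl fun k _ => ?_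
    rw [neg_mul, mul_comm γ]
    ring

theorem integrableOn_mmse (hM : 2 ≤ M) : IntegrableOn S.mmse (Ioi 0) := by
  simpa using S.integrableOn_rpow_mul_mmse hM (s := 0) (by norm_num)

theorem monotoneOn_mutualInfo (hM : 2 ≤ M) : MonotoneOn S.mutualInfo (Ioi 0) := by
  have hd : ∀ γ ∈ Ioi (0 : ℝ), HasDerivAt S.mutualInfo _ γ := fun γ hγ =>
    S.hasDerivAt_mutualInfo hM hγ
  refine monotoneOn_of_deriv_nonneg (convex_Ioi 0)
    (fun γ hγ => (hd γ hγ).continuousAt.continuousWithinAt) ?_ ?_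
  · rw [interior_Ioi]
    exact fun γ hγ => (hd γ hγ).differentiableAt.differentiableWithinAt
  · rw [interior_Ioi]
    intro γ hγ
    rw [(hd γ hγ).deriv]
    exact mul_nonneg logb_exp_one_pos.le (S.mmse_nonneg γ)

theorem integral_Ioi_mmse (hM : 2 ≤ M) (hγ : 0 < γ) :
    ∫ t in Ioi γ, Real.logb 2 (Real.exp 1) * S.mmse t = Real.logb 2 M - S.mutualInfo γ :=
  integral_Ioi_of_hasDerivAt_of_nonneg
    (S.hasDerivAt_mutualInfo hM hγ).continuousAt.continuousWithinAt
    (fun _ ht => S.hasDerivAt_mutualInfo hM (hγ.trans ht))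
    (fun t _ => mul_nonneg logb_exp_one_pos.le (S.mmse_nonneg t)) (S.tendsto_mutualInfo hM)

theorem integrableOn_mul_pdf_gap (hM : 2 ≤ M) {L : ℕ} (P : MixtureGamma L) :
    IntegrableOn (fun y => P.pdf y * (Real.logb 2 M - S.mutualInfo y)) (Ioi 0) :=
  (integral_mul_integral_Ioi P.integrableOn_pdf
    ((S.integrableOn_mmse hM).const_mul (Real.logb 2 (Real.exp 1)))).1.congr
    ((ae_restrict_iff' measurableSet_Ioi).2 (ae_of_all _ fun y hy => by
      simp only [S.integral_Ioi_mmse hM hy]))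

theorem integrableOn_mutualInfo_mul_pdf (hM : 2 ≤ M) {L : ℕ} (P : MixtureGamma L) :
    IntegrableOn (fun γ => S.mutualInfo γ * P.pdf γ) (Ioi 0) :=
  ((P.integrableOn_pdf.const_mul (Real.logb 2 M)).sub (S.integrableOn_mul_pdf_gap hM P)).congr
    (ae_of_all _ fun y => by simp only [Pi.sub_apply]; ring)

theorem rateLimit_eq (hM : 2 ≤ M) {L : ℕ} (P : MixtureGamma L) :
    rateLimit S P = ∫ y in Ioi (0 : ℝ), P.pdf y * (Real.logb 2 M - S.mutualInfo y) := by
  have h : ∀ y, P.pdf y * (Real.logb 2 M - S.mutualInfo y) =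
      Real.logb 2 M * P.pdf y - S.mutualInfo y * P.pdf y := fun y => by ring
  simp only [h]
  rw [integral_sub (P.integrableOn_pdf.const_mul _) (S.integrableOn_mutualInfo_mul_pdf hM P),
    integral_const_mul, P.integral_pdf, mul_one, rateLimit]

theorem integrableOn_mmse_mul_cdf (hM : 2 ≤ M) {L : ℕ} (P : MixtureGamma L) :
    IntegrableOn (fun t => Real.logb 2 (Real.exp 1) * S.mmse t * P.cdf t) (Ioi 0) := by
  refine ((S.integrableOn_mmse hM).const_mul _).mul_bdd (c := 1)
    P.monotone_cdf.measurable.aestronglyMeasurable (ae_of_all _ fun t => ?_)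
  rw [Real.norm_of_nonneg (P.cdf_nonneg t)]
  exact P.cdf_le_one t

/-- The average over the main channel for a fixed SNR `y` of the eavesdropper. -/
theorem integral_max_mul_pdf (hM : 2 ≤ M) {L : ℕ} (P : MixtureGamma L) {y : ℝ} (hy : 0 < y) :
    ∫ x in Ioi (0 : ℝ), max (S.mutualInfo x - S.mutualInfo y) 0 * P.pdf x =
      (Real.logb 2 M - S.mutualInfo y) -
        ∫ t in Ioi y, Real.logb 2 (Real.exp 1) * S.mmse t * P.cdf t := by
  -- Cutting off below `y` encodes the positive part: by monotonicity `max (I x - I y) 0 = I (max x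
  -- y) - I y`, and the tail of `h` beyond `x` is the MMSE tail beyond `max x y`.
  set h : ℝ → ℝ := (Ioi y).indicator fun t => Real.logb 2 (Real.exp 1) * S.mmse t with hh
  have hint : IntegrableOn h (Ioi 0) :=
    ((S.integrableOn_mmse hM).const_mul _).indicator measurableSet_Ioi
  obtain ⟨hi, he⟩ := integral_mul_integral_Ioi P.integrableOn_pdf hint
  have h1 : ∀ x ∈ Ioi (0 : ℝ), max (S.mutualInfo x - S.mutualInfo y) 0 * P.pdf x =
      (Real.logb 2 M - S.mutualInfo y) * P.pdf x - P.pdf x * ∫ t in Ioi x, h t := by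
    intro x hx
    have hx0 : (0 : ℝ) < x := hx
    have h2 : ∫ t in Ioi x, h t = Real.logb 2 M - S.mutualInfo (max x y) := by
      rw [hh, setIntegral_indicator measurableSet_Ioi, Ioi_inter_Ioi]
      exact S.integral_Ioi_mmse hM (hx0.trans_le (le_max_left _ _))
    have h3 : max (S.mutualInfo x - S.mutualInfo y) 0 =
        S.mutualInfo (max x y) - S.mutualInfo y := by
      rcases le_total x y with hxy | hxy
      · have := S.monotoneOn_mutualInfo hM hx hy hxy
        rw [max_eq_right hxy, max_eq_right (sub_nonpos.2 this), sub_self]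
      · have := S.monotoneOn_mutualInfo hM hy hx hxy
        rw [max_eq_left hxy, max_eq_left (sub_nonneg.2 this)]
    rw [h2, h3]
    ring
  rw [setIntegral_congr_fun measurableSet_Ioi h1,
    integral_sub (P.integrableOn_pdf.const_mul _) hi, integral_const_mul, P.integral_pdf, mul_one,
    he]
  congr 1
  have h4 : (fun t => h t * ∫ x in Ioc 0 t, P.pdf x) =
      (Ioi y).indicator fun t => Real.logb 2 (Real.exp 1) * S.mmse t * P.cdf t := by
    funext t
    rw [hh, ← MixtureGamma.cdf]
    exact (indicator_mul_left _ _ _).symm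
  rw [h4, setIntegral_indicator measurableSet_Ioi, Ioi_inter_Ioi, max_eq_right hy.le]

/-- The gap to the limit rate, as a single integral. -/
theorem rateLimit_sub_avgSecrecyRate (hM : 2 ≤ M) {LB LE : ℕ} (bob : MixtureGamma LB)
    (eve : MixtureGamma LE) :
    rateLimit S eve - avgSecrecyRate S bob eve =
      Real.logb 2 (Real.exp 1) * ∫ t in Ioi (0 : ℝ), bob.cdf t * (eve.cdf t * S.mmse t) := by
  -- The second Fubini, over the eavesdropper's SNR, with the MMSE already weighted by `F_B`.
  obtain ⟨hi, he⟩ := integral_mul_integral_Ioi eve.integrableOn_pdf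
    (S.integrableOn_mmse_mul_cdf hM bob)
  have h1 : avgSecrecyRate S bob eve = ∫ y in Ioi (0 : ℝ),
      (eve.pdf y * (Real.logb 2 M - S.mutualInfo y) - eve.pdf y *
        ∫ t in Ioi y, Real.logb 2 (Real.exp 1) * S.mmse t * bob.cdf t) := by
    refine setIntegral_congr_fun measurableSet_Ioi fun y hy => ?_
    rw [integral_mul_const, S.integral_max_mul_pdf hM bob hy]
    ring
  rw [h1, integral_sub (S.integrableOn_mul_pdf_gap hM eve) hi, S.rateLimit_eq hM, sub_sub_cancel,
    he, ← integral_const_mul]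
  refine integral_congr_ae (ae_of_all _ fun t => ?_)
  simp only [MixtureGamma.cdf]
  ring

end

end Constellation

end Wiretap

namespace Wiretap

namespace Constellation

variable {M LB LE : ℕ} (S : Constellation M)

/-! ### The Mellin coefficients -/

theorem integrableOn_rpow_mul_cdf_mul_mmse (hM : 2 ≤ M) (eve : MixtureGamma LE) {s : ℝ}
    (hs : -1 < s) : IntegrableOn (fun t => t ^ s * (eve.cdf t * S.mmse t)) (Ioi 0) := by
  have h := (S.integrableOn_rpow_mul_mmse hM hs).bdd_mul (c := 1)
    (f := eve.cdf) eve.monotone_cdf.measurable.aestronglyMeasurable (ae_of_all _ fun t => by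
      rw [Real.norm_of_nonneg (eve.cdf_nonneg t)]
      exact eve.cdf_le_one t)
  exact h.congr (ae_of_all _ fun t => by simp only; ring)

theorem mellinCoeff_eq (eve : MixtureGamma LE) (s : ℝ) :
    mellinCoeff S eve s = ∫ t in Ioi (0 : ℝ), t ^ s * (eve.cdf t * S.mmse t) := by
  simp only [mellinCoeff, realMellin, add_sub_cancel_right]

theorem mellinCoeff_pos (hM : 2 ≤ M) (eve : MixtureGamma LE) {s : ℝ} (hs : -1 < s) :
    0 < mellinCoeff S eve s := by
  have hpos : ∀ t ∈ Ioi (0 : ℝ), 0 < t ^ s * (eve.cdf t * S.mmse t) := fun t ht =>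
    mul_pos (Real.rpow_pos_of_pos ht _) (mul_pos (eve.cdf_pos ht) (S.mmse_pos hM (le_of_lt ht)))
  rw [mellinCoeff_eq, setIntegral_pos_iff_support_of_nonneg_ae
    ((ae_restrict_iff' measurableSet_Ioi).2 (ae_of_all _ fun t ht => (hpos t ht).le))
    (S.integrableOn_rpow_mul_cdf_mul_mmse hM eve hs),
    inter_eq_right.2 (show Ioi (0 : ℝ) ⊆ Function.support _ from fun t ht => (hpos t ht).ne')]
  simp

theorem hasMellin_cdf_mul_mmse (hM : 2 ≤ M) (eve : MixtureGamma LE) {s : ℝ} (hs : -1 < s) :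
    HasMellin (fun γ : ℝ => ((eve.cdf γ * S.mmse γ : ℝ) : ℂ)) ((s : ℂ) + 1)
      (mellinCoeff S eve s : ℂ) := by
  have h : ∀ t ∈ Ioi (0 : ℝ), (t : ℂ) ^ ((s : ℂ) + 1 - 1) • ((eve.cdf t * S.mmse t : ℝ) : ℂ) =
      ((t ^ s * (eve.cdf t * S.mmse t) : ℝ) : ℂ) := fun t ht => by
    rw [add_sub_cancel_right, ← Complex.ofReal_cpow (le_of_lt ht), smul_eq_mul,
      ← Complex.ofReal_mul]
  constructor
  · exact (integrableOn_congr_fun h measurableSet_Ioi).2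
      (S.integrableOn_rpow_mul_cdf_mul_mmse hM eve hs).ofReal
  · rw [mellin, setIntegral_congr_fun measurableSet_Ioi h, integral_complex_ofReal,
      mellinCoeff_eq]

theorem arrayGain_pos [NeZero LB] (hM : 2 ≤ M) (eve : MixtureGamma LE) {Φ Λ Ψ : Fin LB → ℝ}
    (hΦ : ∀ l, 0 < Φ l) (hΛ : ∀ l, 0 < Λ l) : 0 < arrayGain S eve Φ Λ Ψ := by
  have hpos : ∀ l, 0 < Φ l * mellinCoeff S eve (Λ l) := fun l =>
    mul_pos (hΦ l) (S.mellinCoeff_pos hM eve (by linarith [hΛ l]))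
  refine mul_pos logb_exp_one_pos (Finset.sum_pos' (fun l _ => ?_) ⟨0, Finset.mem_univ _, ?_⟩)
  · split_ifs
    exacts [(hpos l).le, le_rfl]
  · rw [if_pos rfl]; exact hpos 0

/-! ### Asymptotics of the gap to the limit rate -/

/-- The moments of `F_E · MMSE_M`, tilted by a decaying exponential. -/
noncomputable def tiltedMoment (S : Constellation M) (eve : MixtureGamma LE) (s z : ℝ) : ℝ :=
  ∫ t in Ioi (0 : ℝ), Real.exp (-(z * t)) * (t ^ s * (eve.cdf t * S.mmse t))

theorem integrableOn_tilted (hM : 2 ≤ M) (eve : MixtureGamma LE) {s z : ℝ} (hs : -1 < s)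
    (hz : 0 ≤ z) :
    IntegrableOn (fun t => Real.exp (-(z * t)) * (t ^ s * (eve.cdf t * S.mmse t))) (Ioi 0) := by
  refine (S.integrableOn_rpow_mul_cdf_mul_mmse hM eve hs).bdd_mul (c := 1)
    (Continuous.aestronglyMeasurable (by fun_prop))
    ((ae_restrict_iff' measurableSet_Ioi).2 (ae_of_all _ fun t ht => ?_))
  rw [Real.norm_of_nonneg (Real.exp_pos _).le, Real.exp_le_one_iff, neg_nonpos]
  exact mul_nonneg hz (le_of_lt ht)

theorem tendsto_tiltedMoment (hM : 2 ≤ M) (eve : MixtureGamma LE) {s : ℝ} (hs : -1 < s)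
    {z : ℝ → ℝ} (hz : ∀ g, 0 ≤ z g) (hz0 : Tendsto z atTop (𝓝 0)) :
    Tendsto (fun g => S.tiltedMoment eve s (z g)) atTop (𝓝 (mellinCoeff S eve s)) := by
  have hW := S.integrableOn_rpow_mul_cdf_mul_mmse hM eve hs
  rw [mellinCoeff_eq]
  refine tendsto_integral_filter_of_dominated_convergence
    (fun t => ‖t ^ s * (eve.cdf t * S.mmse t)‖) ?_ ?_ hW.norm ?_
  · exact Eventually.of_forall fun g =>
      (S.integrableOn_tilted hM eve hs (hz g)).aestronglyMeasurable
  · refine Eventually.of_forall fun g =>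
      (ae_restrict_iff' measurableSet_Ioi).2 (ae_of_all _ fun t ht => ?_)
    rw [norm_mul, Real.norm_of_nonneg (Real.exp_pos _).le]
    refine mul_le_of_le_one_left (norm_nonneg _) ?_
    rw [Real.exp_le_one_iff, neg_nonpos]
    exact mul_nonneg (hz g) (le_of_lt ht)
  · refine ae_of_all _ fun t => ?_
    have h : Tendsto (fun g => Real.exp (-(z g * t))) atTop (𝓝 (Real.exp (-(0 * t)))) :=
      (Real.continuous_exp.tendsto _).comp (hz0.mul_const t).neg
    simpa using h.mul_const (t ^ s * (eve.cdf t * S.mmse t))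

/-- This selects the terms of the array gain: after normalisation only the exponents `Ψ_l` equal to
`Ψ_0` survive. -/
theorem tendsto_rpow_mul_rpow_neg {a b : ℝ} (hab : a ≤ b) :
    Tendsto (fun g : ℝ => g ^ a * g ^ (-b)) atTop (𝓝 (if b = a then 1 else 0)) := by
  have h : (fun g : ℝ => g ^ (-(b - a))) =ᶠ[atTop] fun g : ℝ => g ^ a * g ^ (-b) := by
    filter_upwards [eventually_gt_atTop 0] with g hg
    rw [← Real.rpow_add hg]
    congr 1
    ring
  refine Tendsto.congr' h ?_
  split_ifs with hb
  · simp [hb]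
  · exact tendsto_rpow_neg_atTop (sub_pos.2 (lt_of_le_of_ne hab (Ne.symm hb)))

/-- The gap to the limit rate, normalised by the leading power, tends to the array gain. -/
theorem tendsto_rpow_mul_gap [NeZero LB] (hM : 2 ≤ M) (eve : MixtureGamma LE)
    (bob : ℝ → MixtureGamma LB) (hζ : ∀ l, Tendsto (fun g => (bob g).ζ l) atTop (𝓝 0))
    {Φ Λ Ψ : Fin LB → ℝ} (hΛ : ∀ l, 0 < Λ l) (hΨ : Monotone Ψ)
    (hfading : ∀ᶠ g in atTop, ∀ γ : ℝ, 0 < γ →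
      ∑ l, (bob g).α l / (bob g).β l * γ ^ (bob g).β l =
        ∑ l, Φ l * γ ^ Λ l * g ^ (-Ψ l)) :
    Tendsto (fun g => g ^ Ψ 0 * (rateLimit S eve - avgSecrecyRate S (bob g) eve)) atTop
      (𝓝 (arrayGain S eve Φ Λ Ψ)) := by
  have hΛ1 : ∀ l, -1 < Λ l := fun l => by linarith [hΛ l]
  set c := Real.logb 2 (Real.exp 1) with hc
  have hc0 : 0 < c := logb_exp_one_pos
  set z : ℝ → ℝ := fun g => ∑ l, (bob g).ζ l with hz
  have hz_nonneg : ∀ g, 0 ≤ z g := fun g => Finset.sum_nonneg fun l _ => ((bob g).ζ_pos l).le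
  have hz0 : Tendsto z atTop (𝓝 0) := by
    simpa using tendsto_finsetSum Finset.univ fun l _ => hζ l
  -- The two squeezing bounds have the same shape, with tilted moments below and plain moments
  -- above, so one limit computation covers both.
  have hterm : ∀ m : Fin LB → ℝ → ℝ, (∀ l, Tendsto (m l) atTop (𝓝 (mellinCoeff S eve (Λ l)))) →
      Tendsto (fun g => c * ∑ l, (g ^ Ψ 0 * g ^ (-Ψ l)) * (Φ l * m l g)) atTop
        (𝓝 (arrayGain S eve Φ Λ Ψ)) := fun m hm => by
    have harr : arrayGain S eve Φ Λ Ψ =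
        c * ∑ l, (if Ψ l = Ψ 0 then 1 else 0) * (Φ l * mellinCoeff S eve (Λ l)) := by
      simp only [arrayGain, ite_mul, one_mul, zero_mul, hc]
    rw [harr]
    exact (tendsto_finsetSum _ fun l _ =>
      (tendsto_rpow_mul_rpow_neg (hΨ (Fin.zero_le l))).mul ((hm l).const_mul _)).const_mul _
  have hint : ∀ g, IntegrableOn (fun t => (bob g).cdf t * (eve.cdf t * S.mmse t)) (Ioi 0) :=
    fun g => by
      have h := S.integrableOn_rpow_mul_cdf_mul_mmse hM eve (s := 0) (by norm_num)
      simp only [Real.rpow_zero, one_mul] at h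
      refine h.bdd_mul (c := 1) (bob g).monotone_cdf.measurable.aestronglyMeasurable
        (ae_of_all _ fun t => ?_)
      rw [Real.norm_of_nonneg ((bob g).cdf_nonneg t)]
      exact (bob g).cdf_le_one t
  have hW : ∀ t, 0 ≤ eve.cdf t * S.mmse t := fun t => mul_nonneg (eve.cdf_nonneg t)
    (S.mmse_nonneg t)
  refine tendsto_of_tendsto_of_tendsto_of_le_of_le'
    (hterm (fun l g => S.tiltedMoment eve (Λ l) (z g))
      fun l => S.tendsto_tiltedMoment hM eve (hΛ1 l) hz_nonneg hz0)
    (hterm (fun l _ => mellinCoeff S eve (Λ l)) fun l => tendsto_const_nhds) ?_ ?_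
  · filter_upwards [hfading, eventually_gt_atTop 0] with g hg hg0
    rw [S.rateLimit_sub_avgSecrecyRate hM, ← hc, mul_left_comm]
    refine mul_le_mul_of_nonneg_left ?_ hc0.le
    simp only [mul_assoc]
    rw [← Finset.mul_sum]
    refine mul_le_mul_of_nonneg_left ?_ (Real.rpow_nonneg hg0.le _)
    have hi : ∀ l ∈ Finset.univ, IntegrableOn (fun t => g ^ (-Ψ l) * (Φ l *
        (Real.exp (-(z g * t)) * (t ^ Λ l * (eve.cdf t * S.mmse t))))) (Ioi 0) := fun l _ =>
      ((S.integrableOn_tilted hM eve (hΛ1 l) (hz_nonneg g)).const_mul _).const_mul _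
    simp only [tiltedMoment, ← integral_const_mul]
    rw [← integral_finsetSum _ hi]
    refine setIntegral_mono_on (integrable_finsetSum _ hi) (hint g) measurableSet_Ioi
      fun t ht => ?_
    refine le_trans (le_of_eq ?_) (mul_le_mul_of_nonneg_right
      ((bob g).exp_mul_powerSum_le_cdf (le_of_lt ht)) (hW t))
    rw [hg t ht]
    change _ = Real.exp (-(z g * t)) * _ * _
    generalize Real.exp (-(z g * t)) = e
    rw [Finset.mul_sum, Finset.sum_mul]
    exact Finset.sum_congr rfl fun l _ => by ring
  · filter_upwards [hfading, eventually_gt_atTop 0] with g hg hg0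
    rw [S.rateLimit_sub_avgSecrecyRate hM, ← hc, mul_left_comm]
    refine mul_le_mul_of_nonneg_left ?_ hc0.le
    simp only [mul_assoc]
    rw [← Finset.mul_sum]
    refine mul_le_mul_of_nonneg_left ?_ (Real.rpow_nonneg hg0.le _)
    have hi : ∀ l ∈ Finset.univ, IntegrableOn (fun t => g ^ (-Ψ l) * (Φ l *
        (t ^ Λ l * (eve.cdf t * S.mmse t)))) (Ioi 0) := fun l _ =>
      ((S.integrableOn_rpow_mul_cdf_mul_mmse hM eve (hΛ1 l)).const_mul _).const_mul _
    simp only [mellinCoeff_eq, ← integral_const_mul]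
    rw [← integral_finsetSum _ hi]
    refine setIntegral_mono_on (hint g) (integrable_finsetSum _ hi) measurableSet_Ioi
      fun t ht => ?_
    refine (mul_le_mul_of_nonneg_right
      ((bob g).cdf_le_powerSum (le_of_lt ht)) (hW t)).trans_eq ?_
    rw [hg t ht, Finset.sum_mul]
    exact Finset.sum_congr rfl fun l _ => by ring

end Constellation

/-! ### From the normalised gap to the expansion and the diversity order -/

theorem tendsto_zero_of_tendsto_rpow_mul {D : ℝ → ℝ} {p a : ℝ} (hp : 0 < p)
    (h : Tendsto (fun g => g ^ p * D g) atTop (𝓝 a)) : Tendsto D atTop (𝓝 0) := by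
  have h1 := (tendsto_rpow_neg_atTop hp).mul h
  rw [zero_mul] at h1
  refine h1.congr' ?_
  filter_upwards [eventually_gt_atTop 0] with g hg
  rw [← mul_assoc, ← Real.rpow_add hg, neg_add_cancel, Real.rpow_zero, one_mul]

theorem isLittleO_of_tendsto_rpow_mul {D : ℝ → ℝ} {p a : ℝ}
    (h : Tendsto (fun g => g ^ p * D g) atTop (𝓝 a)) :
    (fun g => a * g ^ (-p) - D g) =o[atTop] fun g : ℝ => g ^ (-p) := by
  rw [isLittleO_iff_tendsto']
  · have h1 := (tendsto_const_nhds (x := a)).sub h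
    rw [sub_self] at h1
    refine h1.congr' ?_
    filter_upwards [eventually_gt_atTop 0] with g hg
    have := Real.rpow_pos_of_pos hg p
    rw [Real.rpow_neg hg.le]
    field_simp
  · filter_upwards [eventually_gt_atTop 0] with g hg h0
    exact absurd h0 (Real.rpow_pos_of_pos hg _).ne'

/-- Since `a > 0`, `log (g ^ p * D g)` converges and is negligible against `log g`; it equals `p log
g + log (D g)` once `D g` is positive, which the limit itself guarantees eventually. -/
theorem tendsto_log_div_log_of_tendsto_rpow_mul {D : ℝ → ℝ} {p a : ℝ} (ha : 0 < a)
    (h : Tendsto (fun g => g ^ p * D g) atTop (𝓝 a)) :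
    Tendsto (fun g => -(Real.log (D g) / Real.log g)) atTop (𝓝 p) := by
  have h1 : Tendsto (fun g => Real.log (g ^ p * D g) / Real.log g) atTop (𝓝 0) :=
    ((Real.continuousAt_log ha.ne').tendsto.comp h).div_atTop Real.tendsto_log_atTop
  have h2 := (tendsto_const_nhds (x := p)).sub h1
  rw [sub_zero] at h2
  refine h2.congr' ?_
  filter_upwards [eventually_gt_atTop 1, h.eventually (lt_mem_nhds ha)] with g hg hpos
  have hg0 : 0 < g := one_pos.trans hg
  have hgp := Real.rpow_pos_of_pos hg0 p
  have hD : 0 < D g := pos_of_mul_pos_right hpos hgp.le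
  have hl : Real.log g ≠ 0 := (Real.log_pos hg).ne'
  rw [Real.log_mul hgp.ne' hD.ne', Real.log_rpow hg0]
  field_simp
  ring

end Wiretap

theorem mainTheorem3 {M LB LE : ℕ} [NeZero LB] (hM : 2 ≤ M)
    (S : Wiretap.Constellation M)
    (eve : Wiretap.MixtureGamma LE)
    -- the main channel, as a function of its average SNR
    (bob : ℝ → Wiretap.MixtureGamma LB)
    (hmean : ∀ᶠ g in atTop, (bob g).mean = g)
    (hζ : ∀ l, Tendsto (fun g => (bob g).ζ l) atTop (𝓝 0))
    -- the constants of the fading type of the main channel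
    (Φ Λ Ψ : Fin LB → ℝ)
    (hΦ : ∀ l, 0 < Φ l) (hΛ0 : 0 < Λ 0) (hΛ : Monotone Λ) (hΨ0 : 0 < Ψ 0) (hΨ : Monotone Ψ)
    (hfading : ∀ᶠ g in atTop, ∀ γ : ℝ, 0 < γ →
      ∑ l, (bob g).α l / (bob g).β l * γ ^ (bob g).β l = ∑ l, Φ l * γ ^ Λ l * g ^ (-Ψ l)) :
    -- the integral in the limit rate converges absolutely
    IntegrableOn (fun γ => S.mutualInfo γ * eve.pdf γ) (Ioi 0) ∧
    -- the Mellin transforms converge and are positive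
    (∀ l, HasMellin (fun γ : ℝ => ((eve.cdf γ * S.mmse γ : ℝ) : ℂ)) ((Λ l : ℂ) + 1)
        (Wiretap.mellinCoeff S eve (Λ l) : ℂ) ∧
      0 < Wiretap.mellinCoeff S eve (Λ l)) ∧
    0 < Wiretap.arrayGain S eve Φ Λ Ψ ∧
    -- the asymptotic expansion
    (fun g => Wiretap.avgSecrecyRate S (bob g) eve -
        (Wiretap.rateLimit S eve - Wiretap.arrayGain S eve Φ Λ Ψ * g ^ (-Ψ 0)))
      =o[atTop] (fun g : ℝ => g ^ (-Ψ 0)) ∧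
    -- saturation, with secrecy diversity order `Ψ 0`
    Tendsto (fun g => Wiretap.avgSecrecyRate S (bob g) eve) atTop
      (𝓝 (Wiretap.rateLimit S eve)) ∧
    Tendsto (fun g => -(Real.log (Wiretap.rateLimit S eve - Wiretap.avgSecrecyRate S (bob g) eve)
        / Real.log g)) atTop (𝓝 (Ψ 0)) := by

  have hΛp : ∀ l, 0 < Λ l := fun l => hΛ0.trans_le (hΛ (Fin.zero_le l))
  have hΛ1 : ∀ l, -1 < Λ l := fun l => by linarith [hΛp l]
  have hGa := S.arrayGain_pos hM eve (Ψ := Ψ) hΦ hΛp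
  -- All three asymptotic assertions are read off from this single limit.
  have hlim := S.tendsto_rpow_mul_gap hM eve bob hζ hΛp hΨ hfading
  refine ⟨S.integrableOn_mutualInfo_mul_pdf hM eve, fun l =>
    ⟨S.hasMellin_cdf_mul_mmse hM eve (hΛ1 l), S.mellinCoeff_pos hM eve (hΛ1 l)⟩, hGa, ?_, ?_,
    Wiretap.tendsto_log_div_log_of_tendsto_rpow_mul hGa hlim⟩
  · refine (Wiretap.isLittleO_of_tendsto_rpow_mul hlim).congr_left fun g => ?_
    ring
  · have h := (tendsto_const_nhds (x := Wiretap.rateLimit S eve)).sub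
      (Wiretap.tendsto_zero_of_tendsto_rpow_mul hΨ0 hlim)
    simpa only [sub_sub_cancel, sub_zero] using h
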